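/- Let $d\ge 2$ and let $\mathbb{TP}^d=\mathbb R^{d+1}/\mathbb R(1,\dots,1)$ be the tropical projective space, with the quotient topology; coordinates are indexed by $0,\dots,d$, and $e_0,\dots,e_d$ are the unit vectors of $\mathbb R^{d+1}$. The tropical determinant of $M=(m_{ij})\in\mathbb R^{(d+1)\times(d+1)}$ is $\min_{\sigma}\sum_{i=0}^d m_{i,\sigma(i)}$, over all permutations $\sigma$ of $\{0,\dots,d\}$. The tropical sign $\operatorname{tsgn} M$ is $0$ if this minimum is attained by at least two permutations, and otherwise the sign of the unique minimizing permutation; it does not change when a constant is added to all entries of a row. For $p_1,\dots,p_d\in\mathbb{TP}^d$ and $x\in\mathbb{TP}^d$ let $\tau_{p_1,\dots,p_d}(x)=\operatorname{tsgn}(x,p_1,\dots,p_d)$ be the tropical sign of the matrix with rows $x,p_1,\dots,p_d$. The tropical hyperplane of $a=(\alpha_0,\dots,\alpha_d)\in\mathbb R^{d+1}$ is the set of points $(\xi_0,\dots,\xi_d)\in\mathbb{TP}^d$ for which $\min_k(\alpha_k+\xi_k)$ is attained at least twice; its apex is $-a$, and its open sectors are the connected components of its complement. A set $S\subset\mathbb{TP}^d$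 is tropically convex if, for all $x,y\in\mathbb R^{d+1}$ representing points of $S$ and all $\lambda,\mu\in\mathbb R$, the vector with coordinates $\min(\lambda+x_i,\mu+y_i)$ represents a point of $S$; the tropical convex hull of a set is the smallest tropically convex set containing it. The second tropical hypersimplex $\Delta_2^d$ is the tropical convex hull of the points $-e_i-e_j$ with $i\neq j$. The vertices of a tropical polytope (the tropical convex hull of finitely many points) are the elements of the least set whose tropical convex hull is that polytope. 1. For all $p_1,\dots,p_d\in\mathbb{TP}^d$, the set $\{x\in\mathbb{TP}^d:\tau_{p_1,\dots,p_d}(x)=1\}$ is either empty or the union of at least one and at most $d$ open sectors of a single tropical hyperplane. 2. Conversely, for every $a\in\mathbb R^{d+1}$ and every set $\mathcal F$ of at most $d$ open sectors of the tropical hyperplane of $a$, there are (not necessarily distinct) vertices $u_1,\dots,u_d$ of $\Delta_2^d$ such that $\{x\in\mathbb{TP}^d:\tau_{-a+u_1,\dots,-a+u_d}(x)=1\}=\bigcup\mathcal F$. In particular, for the hyperplane of the zero form, the points can be chosen among the vertices of $\Delta_2^d$ themselves. -/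

import Mathlib

/-- The `d`-dimensional tropical projective space `ℝ^{d+1} / ℝ(1,…,1)`, with its quotient
topology and its quotient vector space structure. -/
abbrev TropProj (d : ℕ) : Type :=
  (Fin (d + 1) → ℝ) ⧸ (Submodule.span ℝ {(1 : Fin (d + 1) → ℝ)})

/-- The point of tropical projective space with homogeneous coordinates `v`. -/
def tropPoint {d : ℕ} (v : Fin (d + 1) → ℝ) : TropProj d :=
  Submodule.Quotient.mk v

/-- Tropical convexity: `S` contains every tropical linear combination `l ⊙ x ⊕ m ⊙ y`
of any two of its points; here `⊓` is the coordinatewise minimum. -/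
def IsTropConvex {d : ℕ} (S : Set (TropProj d)) : Prop :=
  ∀ x y : Fin (d + 1) → ℝ, tropPoint x ∈ S → tropPoint y ∈ S → ∀ l m : ℝ,
    tropPoint ((fun i => l + x i) ⊓ (fun i => m + y i)) ∈ S

/-- The tropical convex hull: the smallest tropically convex set containing `S`. -/
def tropConv {d : ℕ} (S : Set (TropProj d)) : Set (TropProj d) :=
  ⋂₀ {C | IsTropConvex C ∧ S ⊆ C}

/-- The set of vertices of a tropical polytope `P`: the least set whose tropical convex hull
is `P`, that is, the set of all points that lie in every generating set of `P`. -/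
def tropVertices {d : ℕ} (P : Set (TropProj d)) : Set (TropProj d) :=
  ⋂₀ {V | tropConv V = P}

/-- The `k`-th tropical hypersimplex: the tropical convex hull of the points `∑_{i ∈ J} -e_i`,
where `J` ranges over the `k`-element subsets of `{0, …, d}`. -/
def tropHypersimplex (d k : ℕ) : Set (TropProj d) :=
  tropConv {x | ∃ J : Finset (Fin (d + 1)), J.card = k ∧
    x = tropPoint (∑ i ∈ J, -(Pi.single i 1 : Fin (d + 1) → ℝ))}

/-- The tropical hyperplane of the tropical linear form `a`: the points `y` such that
`min_k (a k + y k)` is attained at least twice. -/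
def tropHyperplane {d : ℕ} (a : Fin (d + 1) → ℝ) : Set (TropProj d) :=
  {x | ∃ y : Fin (d + 1) → ℝ, x = tropPoint y ∧
    ∃ i j, i ≠ j ∧ a i + y i = a j + y j ∧ ∀ k, a i + y i ≤ a k + y k}

/-- The open sectors of a tropical hyperplane: the connected components of its complement. -/
def IsOpenSector {d : ℕ} (a : Fin (d + 1) → ℝ) (S : Set (TropProj d)) : Prop :=
  ∃ x ∈ (tropHyperplane a)ᶜ, S = connectedComponentIn (tropHyperplane a)ᶜ x

/-- The tropical determinant `min_σ ∑_i M i (σ i)`. -/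
noncomputable def tropDet {n : ℕ} (M : Matrix (Fin n) (Fin n) ℝ) : ℝ :=
  (Finset.univ : Finset (Equiv.Perm (Fin n))).inf' Finset.univ_nonempty
    (fun σ => ∑ i, M i (σ i))

open Classical in
/-- The tropical sign: the sign of the unique minimizing permutation if `M` is tropically
regular, and `0` if the minimum is attained at least twice. -/
noncomputable def tropSign {n : ℕ} (M : Matrix (Fin n) (Fin n) ℝ) : ℤ :=
  if h : ∃! σ : Equiv.Perm (Fin n), ∑ i, M i (σ i) = tropDet M then
    ((Equiv.Perm.sign h.exists.choose : ℤˣ) : ℤ)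
  else 0

/-- The tropical sign of a sequence of `d + 1` points of tropical projective space, computed from
arbitrary homogeneous coordinates; `tropSignPoints_tropPoint` shows independence of the choice. -/
noncomputable def tropSignPoints {d : ℕ} (v : Fin (d + 1) → TropProj d) : ℤ :=
  tropSign (Matrix.of fun i => Quotient.out (v i))

/-- The function `τ_{p_1,…,p_d}` sending `x` to the tropical sign of the matrix with rows
`x, p_1, …, p_d`. -/
noncomputable def tropTau {d : ℕ} (p : Fin d → TropProj d) (x : TropProj d) : ℤ :=
  tropSignPoints (Fin.cons x p : Fin (d + 1) → TropProj d)

theorem tropSign_eq_of_forall_unique {n : ℕ} {M : Matrix (Fin n) (Fin n) ℝ}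
    {σ : Equiv.Perm (Fin n)} (hσ : ∑ i, M i (σ i) = tropDet M)
    (hu : ∀ ρ : Equiv.Perm (Fin n), ∑ i, M i (ρ i) = tropDet M → ρ = σ) :
    tropSign M = ((Equiv.Perm.sign σ : ℤˣ) : ℤ) := by
  have h : ∃! σ : Equiv.Perm (Fin n), ∑ i, M i (σ i) = tropDet M := ⟨σ, hσ, hu⟩
  rw [tropSign, dif_pos h, hu _ h.exists.choose_spec]

theorem tropDet_scale {n : ℕ} (M : Matrix (Fin n) (Fin n) ℝ) (l : Fin n → ℝ) :
    tropDet (Matrix.of fun i j => l i + M i j) = (∑ i, l i) + tropDet M := by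
  apply le_antisymm
  · obtain ⟨σ, -, hσ⟩ := Finset.exists_mem_eq_inf' (Finset.univ_nonempty)
      (fun σ : Equiv.Perm (Fin n) => ∑ i, M i (σ i))
    refine (Finset.inf'_le _ (Finset.mem_univ σ)).trans ?_
    rw [tropDet, hσ]
    simp [Finset.sum_add_distrib]
  · refine Finset.le_inf' _ _ fun σ _ => ?_
    have := Finset.inf'_le (fun σ : Equiv.Perm (Fin n) => ∑ i, M i (σ i)) (Finset.mem_univ σ)
    simpa only [Matrix.of_apply, Finset.sum_add_distrib, tropDet, Equiv.sum_comp,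
      add_le_add_iff_left] using this

theorem tropSign_scale {n : ℕ} (M : Matrix (Fin n) (Fin n) ℝ) (l : Fin n → ℝ) :
    tropSign (Matrix.of fun i j => l i + M i j) = tropSign M := by
  have key : ∀ σ : Equiv.Perm (Fin n),
      (∑ i, (Matrix.of fun i j => l i + M i j) i (σ i) =
        tropDet (Matrix.of fun i j => l i + M i j)) ↔ ∑ i, M i (σ i) = tropDet M := by
    intro σ
    rw [tropDet_scale]
    simp [Finset.sum_add_distrib]
  by_cases h : ∃! σ : Equiv.Perm (Fin n), ∑ i, M i (σ i) = tropDet M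
  · obtain ⟨σ, h1, h2⟩ := h
    rw [tropSign_eq_of_forall_unique h1 h2,
      tropSign_eq_of_forall_unique ((key σ).2 h1) fun ρ hρ => h2 ρ ((key ρ).1 hρ)]
  · have h' : ¬ ∃! σ : Equiv.Perm (Fin n), ∑ i, (Matrix.of fun i j => l i + M i j) i (σ i) =
        tropDet (Matrix.of fun i j => l i + M i j) := by
      simpa only [key] using h
    rw [tropSign, tropSign, dif_neg h, dif_neg h']

theorem tropSignPoints_tropPoint {d : ℕ} (w : Fin (d + 1) → Fin (d + 1) → ℝ) :
    tropSignPoints (fun i => tropPoint (w i)) = tropSign (Matrix.of w) := by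
  have h : ∀ i, ∃ c : ℝ, ∀ j, Quotient.out (tropPoint (w i)) j = c + w i j := by
    intro i
    have h1 : (Submodule.Quotient.mk (Quotient.out (tropPoint (w i))) : TropProj d) =
        Submodule.Quotient.mk (w i) := Quotient.out_eq (tropPoint (w i))
    rw [Submodule.Quotient.eq, Submodule.mem_span_singleton] at h1
    obtain ⟨c, hc⟩ := h1
    refine ⟨c, fun j => ?_⟩
    have := congrFun hc j
    simp at this
    linarith
  choose c hc using h
  rw [← tropSign_scale (Matrix.of w) c, tropSignPoints]
  congr 1
  ext i j
  simp [hc]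

/-!
Expanding the tropical determinant of the matrix with rows `x, p₁, …, p_d` along its first row
gives `min_k (A_k + x_k)`, where `A_k` is the tropical minor of the `p_i` that omits column `k`.
So the matrix is tropically regular exactly if `x` lies in an open sector of the tropical
hyperplane of `A`, say the `k`-th one, and the minor `A_k` has only one minimizing permutation; the
tropical sign is then the sign of this permutation (`tropSign_cons_eq_one_iff`).  Hence
`{τ = 1}` is the union of the sectors `k` with `IsPositiveMinor w A k` (`setOf_tropTau_eq_one`).

Not every `k` can be positive (`exists_not_isPositiveMinor`): fix a row `i`, let `k` minimize
`w i k + A k` and let `σ` be the minimizing permutation for `k`, with `σ i = j`.  Exchanging the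
columns `j` and `k` in `σ` produces a permutation for `j` of cost at most `A j`, so it is
minimizing, and its sign is opposite to that of `σ`.

Conversely, rows `-e_i - e_j` are the edges of a graph on the coordinates.  If this graph is a tree,
then for each `k` there is precisely one way to match the edges with their endpoints so that only
`k` is left over, all tropical minors agree, and the sign of `k` depends only on the side of the
bipartition to which `k` belongs.  A double star with the sides `K` and `Kᶜ` thus realizes the
sectors in `K` for each nonempty proper subset `K` (`exists_perm_doubleStar`), and a repeated row
realizes the empty set.  That each `-e_i - e_j` is a vertex of the hypersimplex
(`tropPoint_mem_tropVertices_tropHypersimplex`) is proved by showing that the hypersimplex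
remains tropically convex without this point.
-/

/-! ### Open sectors of a tropical hyperplane -/

theorem tropPoint_eq_iff {d : ℕ} {x y : Fin (d + 1) → ℝ} :
    tropPoint x = tropPoint y ↔ ∃ c : ℝ, ∀ i, x i = c + y i := by
  rw [tropPoint, tropPoint, Submodule.Quotient.eq, Submodule.mem_span_singleton]
  refine exists_congr fun c => ⟨fun h i => ?_, fun h => funext fun i => ?_⟩
  · have := congrFun h i
    simp at this
    linarith
  · simp [h i]

theorem tropPoint_surjective {d : ℕ} : Function.Surjective (tropPoint (d := d)) :=
  Submodule.Quotient.mk_surjective _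

theorem continuous_tropPoint {d : ℕ} : Continuous (tropPoint (d := d)) :=
  continuous_quotient_mk'

/-- The `k`-th sector of the tropical hyperplane of `a`: the points at which the minimum of
`a j + x j` is attained at `j = k` only. -/
def tropSector {d : ℕ} (a : Fin (d + 1) → ℝ) (k : Fin (d + 1)) : Set (TropProj d) :=
  tropPoint '' {x | ∀ j, j ≠ k → a k + x k < a j + x j}

theorem tropPoint_mem_tropSector {d : ℕ} {a x : Fin (d + 1) → ℝ} {k : Fin (d + 1)} :
    tropPoint x ∈ tropSector a k ↔ ∀ j, j ≠ k → a k + x k < a j + x j := by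
  refine ⟨?_, fun h => ⟨x, h, rfl⟩⟩
  rintro ⟨y, hy, hxy⟩ j hj
  obtain ⟨c, hc⟩ := tropPoint_eq_iff.1 hxy
  have := hy j hj
  rw [hc, hc] at this
  linarith

theorem tropPoint_mem_tropHyperplane {d : ℕ} {a x : Fin (d + 1) → ℝ} :
    tropPoint x ∈ tropHyperplane a ↔
      ∃ i j, i ≠ j ∧ a i + x i = a j + x j ∧ ∀ k, a i + x i ≤ a k + x k := by
  refine ⟨?_, fun h => ⟨x, rfl, h⟩⟩
  rintro ⟨y, hxy, i, j, hij, h1, h2⟩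
  obtain ⟨c, hc⟩ := tropPoint_eq_iff.1 hxy
  refine ⟨i, j, hij, by rw [hc, hc]; linarith, fun k => ?_⟩
  have := h2 k
  rw [hc, hc]
  linarith

theorem compl_tropHyperplane {d : ℕ} (a : Fin (d + 1) → ℝ) :
    (tropHyperplane a)ᶜ = ⋃ k, tropSector a k := by
  ext x
  obtain ⟨x, rfl⟩ := tropPoint_surjective x
  simp only [Set.mem_compl_iff, tropPoint_mem_tropHyperplane, Set.mem_iUnion,
    tropPoint_mem_tropSector]
  constructor
  · intro h
    obtain ⟨k, hk⟩ := Finite.exists_min fun j => a j + x j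
    refine ⟨k, fun j hj => (hk j).lt_of_ne fun e => h ⟨k, j, hj.symm, e, hk⟩⟩
  · rintro ⟨k, hk⟩ ⟨i, j, hij, h1, h2⟩
    by_cases hi : i = k
    · subst hi
      exact (hk j hij.symm).ne h1
    · exact (hk i hi).not_ge (h2 k)

theorem isOpen_tropSector {d : ℕ} (a : Fin (d + 1) → ℝ) (k : Fin (d + 1)) :
    IsOpen (tropSector a k) := by
  have hq : Topology.IsQuotientMap (tropPoint (d := d)) := isQuotientMap_quotient_mk'
  rw [← hq.isOpen_preimage]
  have : tropPoint ⁻¹' tropSector a k =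
      ⋂ j, {x : Fin (d + 1) → ℝ | j ≠ k → a k + x k < a j + x j} := by
    ext x
    simp only [Set.mem_preimage, tropPoint_mem_tropSector, Set.mem_iInter, Set.mem_ofPred_eq]
  rw [this]
  refine isOpen_iInter_of_finite fun j => ?_
  by_cases hj : j = k
  · simp [hj]
  · simpa [hj] using isOpen_lt (by fun_prop : Continuous fun x : Fin (d + 1) → ℝ => a k + x k)
      (by fun_prop)

theorem isPreconnected_tropSector {d : ℕ} (a : Fin (d + 1) → ℝ) (k : Fin (d + 1)) :
    IsPreconnected (tropSector a k) := by
  refine IsPreconnected.image ?_ _ continuous_tropPoint.continuousOn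
  refine Convex.isPreconnected fun x hx y hy s t hs ht hst j hj => ?_
  have h1 := hx j hj
  have h2 := hy j hj
  have e : ∀ i, a i + (s • x + t • y) i = s * (a i + x i) + t * (a i + y i) := fun i => by
    simp only [Pi.add_apply, Pi.smul_apply, smul_eq_mul]
    linear_combination (-a i) * hst
  rw [e, e]
  rcases hs.eq_or_lt with rfl | hs
  · have : t = 1 := by linarith
    simpa [this] using h2
  · exact add_lt_add_of_lt_of_le (mul_lt_mul_of_pos_left h1 hs) (mul_le_mul_of_nonneg_left h2.le ht)

theorem tropSector_nonempty {d : ℕ} (a : Fin (d + 1) → ℝ) (k : Fin (d + 1)) :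
    (tropSector a k).Nonempty := by
  refine ⟨_, (fun j => -a j - (if j = k then 1 else 0)), fun j hj => ?_, rfl⟩
  simp only [if_true, if_neg hj]
  linarith

theorem eq_of_mem_tropSector {d : ℕ} {a : Fin (d + 1) → ℝ} {j k : Fin (d + 1)} {x : TropProj d}
    (hj : x ∈ tropSector a j) (hk : x ∈ tropSector a k) : j = k := by
  obtain ⟨x, rfl⟩ := tropPoint_surjective x
  rw [tropPoint_mem_tropSector] at hj hk
  by_contra h
  exact lt_asymm (hj k (Ne.symm h)) (hk j h)

theorem tropSector_injective {d : ℕ} (a : Fin (d + 1) → ℝ) :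
    Function.Injective (tropSector a) := fun j k h => by
  obtain ⟨x, hx⟩ := tropSector_nonempty a j
  exact eq_of_mem_tropSector hx (h ▸ hx)

theorem tropSector_congr {d : ℕ} {a b : Fin (d + 1) → ℝ} {c : ℝ} (h : ∀ j, b j = a j + c) :
    tropSector b = tropSector a := by
  funext k
  ext x
  obtain ⟨x, rfl⟩ := tropPoint_surjective x
  simp only [tropPoint_mem_tropSector, h, add_right_comm _ c, add_lt_add_iff_right]

/-- The sectors are open, connected and pairwise disjoint, so they are the connected components of
their union. -/
theorem connectedComponentIn_compl_tropHyperplane {d : ℕ} {a : Fin (d + 1) → ℝ}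
    {k : Fin (d + 1)} {x : TropProj d} (hx : x ∈ tropSector a k) :
    connectedComponentIn (tropHyperplane a)ᶜ x = tropSector a k := by
  have hsub : tropSector a k ⊆ (tropHyperplane a)ᶜ := by
    rw [compl_tropHyperplane]
    exact Set.subset_iUnion _ k
  refine Set.Subset.antisymm ?_
    ((isPreconnected_tropSector a k).subset_connectedComponentIn hx hsub)
  refine isPreconnected_connectedComponentIn.subset_left_of_subset_union
    (v := ⋃ j ∈ {j | j ≠ k}, tropSector a j) (isOpen_tropSector a k)
    (isOpen_biUnion fun j _ => isOpen_tropSector a j) ?_ ?_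
    ⟨x, mem_connectedComponentIn (hsub hx), hx⟩
  · rw [Set.disjoint_left]
    intro y hy hy'
    simp only [Set.mem_iUnion] at hy'
    obtain ⟨j, hj, hyj⟩ := hy'
    exact hj (eq_of_mem_tropSector hyj hy)
  · intro y hy
    have hy' := connectedComponentIn_subset _ _ hy
    rw [compl_tropHyperplane, Set.mem_iUnion] at hy'
    obtain ⟨j, hj⟩ := hy'
    by_cases hjk : j = k
    · exact Or.inl (hjk ▸ hj)
    · exact Or.inr (Set.mem_biUnion (show j ∈ {j | j ≠ k} from hjk) hj)

theorem isOpenSector_iff {d : ℕ} {a : Fin (d + 1) → ℝ} {S : Set (TropProj d)} :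
    IsOpenSector a S ↔ S ∈ Set.range (tropSector a) := by
  constructor
  · rintro ⟨x, hx, rfl⟩
    rw [compl_tropHyperplane, Set.mem_iUnion] at hx
    obtain ⟨k, hk⟩ := hx
    exact ⟨k, (connectedComponentIn_compl_tropHyperplane hk).symm⟩
  · rintro ⟨k, rfl⟩
    obtain ⟨x, hx⟩ := tropSector_nonempty a k
    refine ⟨x, ?_, (connectedComponentIn_compl_tropHyperplane hx).symm⟩
    rw [compl_tropHyperplane]
    exact Set.mem_iUnion_of_mem k hx

/-! ### Expansion of the tropical determinant along the first row -/

theorem tropSign_eq_one_iff {n : ℕ} (M : Matrix (Fin n) (Fin n) ℝ) :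
    tropSign M = 1 ↔ ∃ σ : Equiv.Perm (Fin n), Equiv.Perm.sign σ = 1 ∧
      ∀ ρ : Equiv.Perm (Fin n), ρ ≠ σ → ∑ i, M i (σ i) < ∑ i, M i (ρ i) := by
  have hle : ∀ ρ : Equiv.Perm (Fin n), tropDet M ≤ ∑ i, M i (ρ i) := fun ρ =>
    Finset.inf'_le (fun σ : Equiv.Perm (Fin n) => ∑ i, M i (σ i)) (Finset.mem_univ ρ)
  constructor
  · intro h
    by_cases hu : ∃! σ : Equiv.Perm (Fin n), ∑ i, M i (σ i) = tropDet M
    · obtain ⟨σ, h1, h2⟩ := hu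
      rw [tropSign_eq_of_forall_unique h1 h2] at h
      refine ⟨σ, Units.ext h, fun ρ hρ => ?_⟩
      rw [h1]
      exact (hle ρ).lt_of_ne fun e => hρ (h2 ρ e.symm)
    · rw [tropSign, dif_neg hu] at h
      exact absurd h zero_ne_one
  · rintro ⟨σ, h1, h2⟩
    have hσ : ∑ i, M i (σ i) = tropDet M := by
      refine le_antisymm (Finset.le_inf' _ _ fun ρ _ => ?_) (hle σ)
      by_cases hρ : ρ = σ
      · rw [hρ]
      · exact (h2 ρ hρ).le
    rw [tropSign_eq_of_forall_unique hσ, h1, Units.val_one]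
    intro ρ hρ
    by_contra hne
    exact (h2 ρ hne).ne (hσ.trans hρ.symm)

/-- The part of the cost of the permutation `σ` that comes from the rows `w`, which are the
rows `1, …, d` of a square matrix. -/
def restCost {d : ℕ} (w : Fin d → Fin (d + 1) → ℝ) (σ : Equiv.Perm (Fin (d + 1))) : ℝ :=
  ∑ i, w i (σ i.succ)

/-- `A k` is the tropical minor of the rows `w` omitting column `k`, encoded as the least cost
of a permutation that sends the missing row `0` to `k`. -/
def IsTropMinors {d : ℕ} (w : Fin d → Fin (d + 1) → ℝ) (A : Fin (d + 1) → ℝ) : Prop :=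
  (∀ σ : Equiv.Perm (Fin (d + 1)), A (σ 0) ≤ restCost w σ) ∧
    ∀ k, ∃ σ : Equiv.Perm (Fin (d + 1)), σ 0 = k ∧ restCost w σ = A k

/-- The tropical minor `A k` is attained by only one permutation, and this permutation is even. -/
def IsPositiveMinor {d : ℕ} (w : Fin d → Fin (d + 1) → ℝ) (A : Fin (d + 1) → ℝ)
    (k : Fin (d + 1)) : Prop :=
  ∃ σ : Equiv.Perm (Fin (d + 1)), Equiv.Perm.sign σ = 1 ∧ σ 0 = k ∧ restCost w σ = A k ∧
    ∀ ρ : Equiv.Perm (Fin (d + 1)), ρ 0 = k → restCost w ρ = A k → ρ = σ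

theorem exists_isTropMinors {d : ℕ} (w : Fin d → Fin (d + 1) → ℝ) : ∃ A, IsTropMinors w A := by
  have h : ∀ k : Fin (d + 1), ∃ σ : Equiv.Perm (Fin (d + 1)), σ 0 = k ∧
      ∀ ρ : Equiv.Perm (Fin (d + 1)), ρ 0 = k → restCost w σ ≤ restCost w ρ := by
    intro k
    obtain ⟨σ, h1, h2⟩ := Set.exists_min_image {σ : Equiv.Perm (Fin (d + 1)) | σ 0 = k}
      (restCost w) (Set.toFinite _) ⟨Equiv.swap 0 k, Equiv.swap_apply_left 0 k⟩
    exact ⟨σ, h1, h2⟩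
  choose σ h1 h2 using h
  exact ⟨fun k => restCost w (σ k), fun ρ => h2 _ ρ rfl, fun k => ⟨σ k, h1 k, rfl⟩⟩

theorem tropSign_cons_eq_one_iff {d : ℕ} {w : Fin d → Fin (d + 1) → ℝ} {A : Fin (d + 1) → ℝ}
    (hA : IsTropMinors w A) (x : Fin (d + 1) → ℝ) :
    tropSign (Matrix.of (Fin.cons x w : Fin (d + 1) → Fin (d + 1) → ℝ)) = 1 ↔
      ∃ k, IsPositiveMinor w A k ∧ ∀ j, j ≠ k → A k + x k < A j + x j := by
  have hcost : ∀ σ : Equiv.Perm (Fin (d + 1)),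
      ∑ i, Matrix.of (Fin.cons x w : Fin (d + 1) → Fin (d + 1) → ℝ) i (σ i) =
        x (σ 0) + restCost w σ := fun σ => by simp [Fin.sum_univ_succ, restCost]
  simp only [tropSign_eq_one_iff, hcost]
  constructor
  · rintro ⟨σ, hs, hσ⟩
    have hk : restCost w σ = A (σ 0) := by
      obtain ⟨τ, h0, hτ⟩ := hA.2 (σ 0)
      by_cases h : τ = σ
      · rw [← h, hτ, h]
      · have h1 := hσ τ h
        have h2 := hA.1 σ
        rw [h0, hτ] at h1
        linarith
    refine ⟨σ 0, ⟨σ, hs, rfl, hk, fun ρ h0 hρ => ?_⟩, fun j hj => ?_⟩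
    · by_contra h
      have := hσ ρ h
      rw [h0, hρ, hk] at this
      exact lt_irrefl _ this
    · obtain ⟨τ, h0, hτ⟩ := hA.2 j
      have h1 := hσ τ fun e => hj (by rw [← h0, e])
      rw [h0, hτ, hk] at h1
      linarith
  · rintro ⟨k, ⟨σ, hs, h0, hσ, hu⟩, hk⟩
    refine ⟨σ, hs, fun ρ hρ => ?_⟩
    rw [h0, hσ]
    have h1 := hA.1 ρ
    by_cases h : ρ 0 = k
    · rw [h] at h1 ⊢
      have := h1.lt_of_ne fun e => hρ (hu ρ h e.symm)
      linarith
    · have := hk _ h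
      linarith

theorem setOf_tropTau_eq_one {d : ℕ} {w : Fin d → Fin (d + 1) → ℝ} {A : Fin (d + 1) → ℝ}
    (hA : IsTropMinors w A) :
    {x : TropProj d | tropTau (fun i => tropPoint (w i)) x = 1} =
      ⋃₀ (tropSector A '' {k | IsPositiveMinor w A k}) := by
  ext x
  obtain ⟨x, rfl⟩ := tropPoint_surjective x
  have h : (Fin.cons (tropPoint x) fun i => tropPoint (w i) : Fin (d + 1) → TropProj d) =
      fun i => tropPoint ((Fin.cons x w : Fin (d + 1) → Fin (d + 1) → ℝ) i) := by
    funext i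
    refine Fin.cases ?_ (fun i => ?_) i <;> simp
  simp only [Set.mem_ofPred_eq, tropTau, h, tropSignPoints_tropPoint, tropSign_cons_eq_one_iff hA,
    Set.sUnion_image, Set.mem_iUnion, tropPoint_mem_tropSector, exists_prop]

/-- Positivity of all minors is impossible because of an exchange of two columns. -/
theorem exists_not_isPositiveMinor {d : ℕ} [NeZero d] {w : Fin d → Fin (d + 1) → ℝ}
    {A : Fin (d + 1) → ℝ} (hA : IsTropMinors w A) : ∃ k, ¬ IsPositiveMinor w A k := by
  by_contra! hpos
  let i : Fin d := 0
  obtain ⟨k, hk⟩ := Finite.exists_min fun j => w i j + A j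
  obtain ⟨σ, hs, h0, hσ, -⟩ := hpos k
  set ρ := σ * Equiv.swap 0 i.succ with hρ
  have hne : (0 : Fin (d + 1)) ≠ i.succ := (Fin.succ_ne_zero i).symm
  have hρ0 : ρ 0 = σ i.succ := by simp [hρ]
  have hcost : restCost w ρ = restCost w σ - w i (σ i.succ) + w i k := by
    rw [restCost, restCost, ← Finset.add_sum_erase _ _ (Finset.mem_univ i),
      ← Finset.add_sum_erase (a := i) _ (fun i => w i (σ i.succ)) (Finset.mem_univ i)]
    have : ∀ m ∈ Finset.univ.erase i, w m (ρ m.succ) = w m (σ m.succ) := fun m hm => by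
      rw [hρ, Equiv.Perm.mul_apply, Equiv.swap_apply_of_ne_of_ne (Fin.succ_ne_zero m)]
      exact fun e => Finset.ne_of_mem_erase hm (Fin.succ_injective _ e)
    rw [Finset.sum_congr rfl this, hρ, Equiv.Perm.mul_apply, Equiv.swap_apply_right, h0]
    ring
  obtain ⟨τ, ht, -, -, hu⟩ := hpos (σ i.succ)
  have hmin : restCost w ρ = A (σ i.succ) := by
    refine le_antisymm ?_ (hρ0 ▸ hA.1 ρ)
    have := hk (σ i.succ)
    rw [hcost, hσ]
    linarith
  rw [← hu ρ hρ0 hmin, hρ, Equiv.Perm.sign_mul, Equiv.Perm.sign_swap hne, hs] at ht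
  exact absurd ht (by decide)

/-- Two equal rows make every minor singular. -/
theorem not_isPositiveMinor_of_eq {d : ℕ} {w : Fin d → Fin (d + 1) → ℝ} {A : Fin (d + 1) → ℝ}
    {i j : Fin d} (hij : i ≠ j) (h : w i = w j) (k : Fin (d + 1)) : ¬ IsPositiveMinor w A k := by
  rintro ⟨σ, hs, h0, hσ, hu⟩
  have hne : i.succ ≠ j.succ := fun e => hij (Fin.succ_injective _ e)
  have key := hu (σ * Equiv.swap i.succ j.succ) ?_ ?_
  · have := congrArg Equiv.Perm.sign key
    rw [Equiv.Perm.sign_mul, Equiv.Perm.sign_swap hne, hs] at this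
    exact absurd this (by decide)
  · rw [Equiv.Perm.mul_apply, Equiv.swap_apply_of_ne_of_ne (Fin.succ_ne_zero i).symm
      (Fin.succ_ne_zero j).symm, h0]
  · rw [← hσ, restCost, restCost, ← Equiv.sum_comp (Equiv.swap i j)]
    refine Finset.sum_congr rfl fun m _ => ?_
    have hw : w (Equiv.swap i j m) = w m := by
      rcases eq_or_ne m i with rfl | hi
      · rw [Equiv.swap_apply_left, h]
      rcases eq_or_ne m j with rfl | hj
      · rw [Equiv.swap_apply_right, h]
      rw [Equiv.swap_apply_of_ne_of_ne hi hj]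
    have hm : Equiv.swap i.succ j.succ (Equiv.swap i j m).succ = m.succ := by
      rw [(Fin.succ_injective d).swap_apply, Equiv.swap_apply_self]
    rw [hw, Equiv.Perm.mul_apply, hm]

/-! ### Vertices of the second hypersimplex -/

theorem subset_tropConv {d : ℕ} (S : Set (TropProj d)) : S ⊆ tropConv S :=
  fun _ hx _ hC => hC.2 hx

theorem isTropConvex_tropConv {d : ℕ} (S : Set (TropProj d)) : IsTropConvex (tropConv S) :=
  fun x y hx hy l m C hC => hC.1 x y (hx C hC) (hy C hC) l m

theorem tropConv_subset {d : ℕ} {S C : Set (TropProj d)} (hC : IsTropConvex C) (h : S ⊆ C) :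
    tropConv S ⊆ C := fun _ hx => hx C ⟨hC, h⟩

theorem mem_tropVertices_of_isTropConvex_diff {d : ℕ} {P : Set (TropProj d)} {v : TropProj d}
    (hv : v ∈ P) (h : IsTropConvex (P \ {v})) : v ∈ tropVertices P := by
  intro V hV
  by_contra hvV
  have hsub : tropConv V ⊆ P \ {v} := tropConv_subset h fun x hx =>
    ⟨hV ▸ subset_tropConv V hx, fun e => hvV (Set.mem_singleton_iff.1 e ▸ hx)⟩
  exact (hsub (hV.symm ▸ hv)).2 rfl

theorem sum_neg_single_apply {d : ℕ} (J : Finset (Fin (d + 1))) (c : Fin (d + 1)) :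
    (∑ i ∈ J, -(Pi.single i 1 : Fin (d + 1) → ℝ)) c = if c ∈ J then -1 else 0 := by
  rw [Finset.sum_apply]
  by_cases hc : c ∈ J <;> simp [Pi.single_apply, hc]

/-- The tropical half-space `x_k ≤ 1 + x_i` contains the hypersimplex. -/
theorem le_one_add_of_mem_tropHypersimplex {d n : ℕ} {x : Fin (d + 1) → ℝ}
    (hx : tropPoint x ∈ tropHypersimplex d n) (i k : Fin (d + 1)) : x k ≤ 1 + x i := by
  let C : Set (TropProj d) := {p | ∀ y, tropPoint y = p → y k ≤ 1 + y i}
  have hC : IsTropConvex C := by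
    intro y z hy hz l m u hu
    have h1 := hy y rfl
    have h2 := hz z rfl
    obtain ⟨c, hc⟩ := tropPoint_eq_iff.1 hu
    rw [hc, hc]
    simp only [Pi.inf_apply]
    rcases min_cases (l + y i) (m + z i) with ⟨e, -⟩ | ⟨e, -⟩ <;> rw [e]
    · linarith [min_le_left (l + y k) (m + z k)]
    · linarith [min_le_right (l + y k) (m + z k)]
  refine tropConv_subset hC ?_ hx x rfl
  rintro _ ⟨J, -, rfl⟩ u hu
  obtain ⟨c, hc⟩ := tropPoint_eq_iff.1 hu
  rw [hc, hc, sum_neg_single_apply, sum_neg_single_apply]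
  split_ifs <;> linarith

/-- The tropical half-space `min_{k ≠ i} x_k ≤ x_i` contains the second hypersimplex. -/
theorem exists_le_of_mem_tropHypersimplex_two {d : ℕ} {x : Fin (d + 1) → ℝ}
    (hx : tropPoint x ∈ tropHypersimplex d 2) (i : Fin (d + 1)) : ∃ k, k ≠ i ∧ x k ≤ x i := by
  let C : Set (TropProj d) := {p | ∀ y, tropPoint y = p → ∃ k, k ≠ i ∧ y k ≤ y i}
  have hC : IsTropConvex C := by
    intro y z hy hz l m u hu
    obtain ⟨k1, hk1, h1⟩ := hy y rfl
    obtain ⟨k2, hk2, h2⟩ := hz z rfl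
    obtain ⟨c, hc⟩ := tropPoint_eq_iff.1 hu
    simp only [hc, Pi.inf_apply]
    rcases min_cases (l + y i) (m + z i) with ⟨e, -⟩ | ⟨e, -⟩ <;> rw [e]
    · exact ⟨k1, hk1, by linarith [min_le_left (l + y k1) (m + z k1)]⟩
    · exact ⟨k2, hk2, by linarith [min_le_right (l + y k2) (m + z k2)]⟩
  refine tropConv_subset hC ?_ hx x rfl
  rintro _ ⟨J, hJ, rfl⟩ u hu
  obtain ⟨c, hc⟩ := tropPoint_eq_iff.1 hu
  obtain ⟨k, hk, hki⟩ := Finset.exists_mem_ne (by omega : 1 < J.card) i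
  refine ⟨k, hki, ?_⟩
  rw [hc, hc, sum_neg_single_apply, sum_neg_single_apply, if_pos hk]
  split_ifs <;> linarith

/-- A point of the second hypersimplex that has a representative above the vector
`v = -e_i - e_j`, and equal to it in coordinate `i`, is the point of `v`. -/
theorem tropPoint_eq_of_ge {d : ℕ} {i j : Fin (d + 1)} (hij : i ≠ j) {x : Fin (d + 1) → ℝ} {l : ℝ}
    (hx : tropPoint x ∈ tropHypersimplex d 2) (hi : l + x i = -1)
    (hge : ∀ k, (if k ∈ ({i, j} : Finset (Fin (d + 1))) then (-1 : ℝ) else 0) ≤ l + x k) :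
    tropPoint x = tropPoint (∑ k ∈ {i, j}, -(Pi.single k 1 : Fin (d + 1) → ℝ)) := by
  refine tropPoint_eq_iff.2 ⟨-l, fun k => ?_⟩
  rw [sum_neg_single_apply]
  have hk := hge k
  rcases eq_or_ne k i with rfl | hki
  · simp only [Finset.mem_insert_self, if_true]
    linarith
  rcases eq_or_ne k j with rfl | hkj
  · obtain ⟨m, hm, hle⟩ := exists_le_of_mem_tropHypersimplex_two hx i
    have hmk : m = k := by
      by_contra h
      have := hge m
      rw [if_neg (by simp [hm, h])] at this
      linarith
    subst hmk
    rw [if_pos (by simp)] at hk ⊢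
    linarith
  · have := le_one_add_of_mem_tropHypersimplex hx i k
    rw [if_neg (by simp [hki, hkj])] at hk ⊢
    linarith

theorem tropPoint_mem_tropVertices_tropHypersimplex {d : ℕ} {i j : Fin (d + 1)} (hij : i ≠ j) :
    tropPoint (∑ k ∈ {i, j}, -(Pi.single k 1 : Fin (d + 1) → ℝ)) ∈
      tropVertices (tropHypersimplex d 2) := by
  refine mem_tropVertices_of_isTropConvex_diff
    (subset_tropConv _ ⟨{i, j}, Finset.card_pair hij, rfl⟩) ?_
  rintro x y ⟨hx, hxv⟩ ⟨hy, hyv⟩ l m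
  refine ⟨isTropConvex_tropConv _ x y hx hy l m, fun e => ?_⟩
  obtain ⟨c, hc⟩ := tropPoint_eq_iff.1 (Set.mem_singleton_iff.1 e)
  simp only [sum_neg_single_apply, Pi.inf_apply] at hc
  have hi := hc i
  rw [if_pos (by simp)] at hi
  rcases min_choice (l + x i) (m + y i) with h | h
  · refine hxv (tropPoint_eq_of_ge hij (l := l - c) hx (by linarith) fun k => ?_)
    linarith [hc k, min_le_left (l + x k) (m + y k)]
  · refine hyv (tropPoint_eq_of_ge hij (l := m - c) hy (by linarith) fun k => ?_)
    linarith [hc k, min_le_right (l + x k) (m + y k)]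

/-! ### Double stars -/

/-- The edges `{v, parent v}` for `v ≠ r`, with `parent v = s` on `K` and `parent v = r` off `K`,
form a double star with centers `r ∈ K` and `s ∉ K` and bipartition `(K, Kᶜ)`.  A permutation `ρ`
with `ρ r = k` that sends each `v ≠ r` to an endpoint of its edge must permute the vertices of the
path from `r` to `k` cyclically and fix all others, and this path has even length exactly if
`k ∈ K`. -/
theorem exists_perm_doubleStar {V : Type*} [Fintype V] [DecidableEq V] (K : Set V)
    [DecidablePred (· ∈ K)] {r s : V} (hr : r ∈ K) (hs : s ∉ K) (k : V) :
    ∃ ρ : Equiv.Perm V, (ρ r = k ∧ ∀ v, v ≠ r → ρ v = v ∨ ρ v = if v ∈ K then s else r) ∧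
      (Equiv.Perm.sign ρ = 1 ↔ k ∈ K) ∧
      ∀ ρ' : Equiv.Perm V, (ρ' r = k ∧ ∀ v, v ≠ r → ρ' v = v ∨ ρ' v = if v ∈ K then s else r) →
        ρ' = ρ := by
  have hrs : r ≠ s := fun h => hs (h ▸ hr)
  -- The edges of `s` lead to `r` and to `K`, so `s` moves exactly if the path from `r` to `k`
  -- leaves `r` through `s`.
  have huniq : ∀ ρ ρ' : Equiv.Perm V,
      (ρ r = k ∧ ∀ v, v ≠ r → ρ v = v ∨ ρ v = if v ∈ K then s else r) →
      (ρ' r = k ∧ ∀ v, v ≠ r → ρ' v = v ∨ ρ' v = if v ∈ K then s else r) → ρ' = ρ := by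
    have hcenter : ∀ ρ : Equiv.Perm V,
        (ρ r = k ∧ ∀ v, v ≠ r → ρ v = v ∨ ρ v = if v ∈ K then s else r) →
        ρ s = if k = s ∨ k ∈ K ∧ k ≠ r then r else s := by
      rintro ρ ⟨h0, h⟩
      have h1 := h s hrs.symm
      have h2 := h k
      have h3 := fun u v => ρ.injective.eq_iff (a := u) (b := v)
      grind
    intro ρ ρ' H H'
    have h1 := hcenter ρ H
    have h1' := hcenter ρ' H'
    obtain ⟨h0, h⟩ := H
    obtain ⟨h0', h'⟩ := H'
    -- Besides its own edge, only the positions of `r`, `s` and `k` constrain the image of `v`.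
    ext v
    have h2 := h v
    have h2' := h' v
    have h3 := h k
    have h3' := h' k
    have i1 := ρ.injective.eq_iff (a := v) (b := r)
    have i2 := ρ.injective.eq_iff (a := v) (b := s)
    have i3 := ρ.injective.eq_iff (a := v) (b := k)
    have i4 := ρ.injective.eq_iff (a := k) (b := r)
    have i1' := ρ'.injective.eq_iff (a := v) (b := r)
    have i2' := ρ'.injective.eq_iff (a := v) (b := s)
    have i3' := ρ'.injective.eq_iff (a := v) (b := k)
    have i4' := ρ'.injective.eq_iff (a := k) (b := r)
    clear h h' hcenter
    grind
  rcases eq_or_ne k r with rfl | hkr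
  · have h : (1 : Equiv.Perm V) k = k ∧
        ∀ v, v ≠ k → (1 : Equiv.Perm V) v = v ∨ (1 : Equiv.Perm V) v = if v ∈ K then s else k :=
      ⟨rfl, fun v _ => Or.inl rfl⟩
    exact ⟨1, h, by simp [hr], fun ρ' => huniq 1 ρ' h⟩
  by_cases hk : k ∈ K
  · have hks : k ≠ s := fun h => hs (h ▸ hk)
    have h : (Equiv.swap s r * Equiv.swap r k) r = k ∧ ∀ v, v ≠ r →
        (Equiv.swap s r * Equiv.swap r k) v = v ∨
          (Equiv.swap s r * Equiv.swap r k) v = if v ∈ K then s else r := by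
      simp only [Equiv.Perm.mul_apply, Equiv.swap_apply_def]
      grind
    refine ⟨_, h, ?_, fun ρ' => huniq _ ρ' h⟩
    rw [Equiv.Perm.sign_mul, Equiv.Perm.sign_swap hrs.symm, Equiv.Perm.sign_swap hkr.symm]
    simp [hk]
  · have h : (Equiv.swap r k) r = k ∧ ∀ v, v ≠ r →
        (Equiv.swap r k) v = v ∨ (Equiv.swap r k) v = if v ∈ K then s else r := by
      simp only [Equiv.swap_apply_def]
      grind
    refine ⟨_, h, ?_, fun ρ' => huniq _ ρ' h⟩
    rw [Equiv.Perm.sign_swap hkr.symm]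
    simp only [hk, iff_false]
    decide

/-- In dimension at least two, any given row can be put first by an even permutation. -/
theorem exists_even_perm_apply_zero {d : ℕ} (hd : 2 ≤ d) (r : Fin (d + 1)) :
    ∃ e : Equiv.Perm (Fin (d + 1)), e 0 = r ∧ Equiv.Perm.sign e = 1 := by
  rcases eq_or_ne r 0 with rfl | hr
  · exact ⟨1, rfl, map_one _⟩
  let a : Fin (d + 1) := ⟨1, by omega⟩
  let b : Fin (d + 1) := ⟨2, by omega⟩
  have ha : (0 : Fin (d + 1)) ≠ a := by simp [a, Fin.ext_iff]
  have hb : (0 : Fin (d + 1)) ≠ b := by simp [b, Fin.ext_iff]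
  have hab : a ≠ b := by simp [a, b, Fin.ext_iff]
  refine ⟨Equiv.swap 0 r * Equiv.swap a b, ?_, ?_⟩
  · rw [Equiv.Perm.mul_apply, Equiv.swap_apply_of_ne_of_ne ha hb, Equiv.swap_apply_left]
  · rw [Equiv.Perm.sign_mul, Equiv.Perm.sign_swap hr.symm, Equiv.Perm.sign_swap hab]
    decide

open Classical in
/-- Each nonempty proper subset `K` of the coordinates is the set of positive minors of a
translate by `-a` of a double star, and the minors agree with `a` up to a constant. -/
theorem exists_vertices_isPositiveMinor_iff {d : ℕ} (hd : 2 ≤ d) (a : Fin (d + 1) → ℝ)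
    {K : Set (Fin (d + 1))} {r s : Fin (d + 1)} (hr : r ∈ K) (hs : s ∉ K) :
    ∃ (J : Fin d → Finset (Fin (d + 1))) (c : ℝ),
      (∀ i, ∃ v v', v ≠ v' ∧ J i = {v, v'}) ∧
      IsTropMinors (fun i => -a + ∑ m ∈ J i, -(Pi.single m 1 : Fin (d + 1) → ℝ))
        (fun k => a k + c) ∧
      ∀ k, IsPositiveMinor (fun i => -a + ∑ m ∈ J i, -(Pi.single m 1 : Fin (d + 1) → ℝ))
        (fun k => a k + c) k ↔ k ∈ K := by
  obtain ⟨e, he0, hes⟩ := exists_even_perm_apply_zero hd r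
  let parent : Fin (d + 1) → Fin (d + 1) := fun v => if v ∈ K then s else r
  let J : Fin d → Finset (Fin (d + 1)) := fun i => {e i.succ, parent (e i.succ)}
  let w : Fin d → Fin (d + 1) → ℝ :=
    fun i => -a + ∑ m ∈ J i, -(Pi.single m 1 : Fin (d + 1) → ℝ)
  let c : ℝ := -∑ k, a k - d
  have hne : ∀ i : Fin d, e i.succ ≠ r := fun i h =>
    Fin.succ_ne_zero i (e.injective (h.trans he0.symm))
  have hcost : ∀ σ, restCost w σ =
      a (σ 0) + c + ∑ i : Fin d, if σ i.succ ∈ J i then (0 : ℝ) else 1 := by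
    intro σ
    have h1 : ∑ k, a k = a (σ 0) + ∑ i : Fin d, a (σ i.succ) := by
      rw [← Equiv.sum_comp σ a, Fin.sum_univ_succ]
    have h2 : ∀ i : Fin d, w i (σ i.succ) =
        -a (σ i.succ) + ((if σ i.succ ∈ J i then (0 : ℝ) else 1) - 1) := fun i => by
      simp only [w, Pi.add_apply, Pi.neg_apply, sum_neg_single_apply]
      split_ifs <;> ring
    simp only [restCost, h2, Finset.sum_add_distrib, Finset.sum_sub_distrib, Finset.sum_neg_distrib,
      Finset.sum_const, Finset.card_univ, Fintype.card_fin, nsmul_eq_mul, mul_one, c]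
    linarith
  have hnonneg : ∀ (σ : Equiv.Perm (Fin (d + 1))) (i : Fin d),
      (0 : ℝ) ≤ if σ i.succ ∈ J i then (0 : ℝ) else 1 := fun σ i => by split_ifs <;> norm_num
  -- A permutation `σ` of rows and columns becomes a permutation of vertices via `e`.
  have hiff : ∀ σ k, (σ 0 = k ∧ restCost w σ = a k + c) ↔ ((σ * e⁻¹) r = k ∧
      ∀ v, v ≠ r → (σ * e⁻¹) v = v ∨ (σ * e⁻¹) v = if v ∈ K then s else r) := by
    intro σ k
    have h0 : (σ * e⁻¹) r = σ 0 := by simp [← he0]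
    rw [h0]
    refine and_congr_right fun hk => ?_
    rw [hcost, hk, add_eq_left, Finset.sum_eq_zero_iff_of_nonneg fun i _ => hnonneg σ i]
    constructor
    · intro h v hv
      obtain ⟨m, rfl⟩ := e.surjective v
      obtain ⟨i, rfl⟩ := Fin.exists_succ_eq.2 (fun h0 : m = 0 => hv (h0 ▸ he0))
      have := h i (Finset.mem_univ i)
      simpa [J, parent, or_iff_not_imp_left] using this
    · intro h i _
      simpa [J, parent, or_iff_not_imp_left] using h _ (hne i)
  have hsign : ∀ σ : Equiv.Perm (Fin (d + 1)),
      Equiv.Perm.sign (σ * e⁻¹) = Equiv.Perm.sign σ := fun σ => by simp [hes]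
  refine ⟨J, c, fun i => ⟨_, _, fun h => ?_, rfl⟩, ⟨fun σ => ?_, fun k => ?_⟩, fun k => ?_⟩
  · by_cases hK : e i.succ ∈ K
    · have h' : e i.succ = s := by simpa only [parent, if_pos hK] using h
      exact hs (h' ▸ hK)
    · exact hne i (by simpa only [parent, if_neg hK] using h)
  · change a (σ 0) + c ≤ restCost w σ
    rw [hcost]
    linarith [Finset.sum_nonneg fun i (_ : i ∈ Finset.univ) => hnonneg σ i]
  · obtain ⟨ρ, hρ, -⟩ := exists_perm_doubleStar K hr hs k
    exact ⟨ρ * e, (hiff (ρ * e) k).2 (by simpa using hρ)⟩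
  · obtain ⟨ρ, hρ, hρs, hu⟩ := exists_perm_doubleStar K hr hs k
    rw [← hρs]
    constructor
    · rintro ⟨σ, h1, h2, h3, -⟩
      rw [← hu _ ((hiff σ k).1 ⟨h2, h3⟩), hsign, h1]
    · intro h1
      obtain ⟨h2, h3⟩ := (hiff (ρ * e) k).2 (by simpa using hρ)
      refine ⟨ρ * e, by simp [h1, hes], h2, h3, fun σ h4 h5 => ?_⟩
      rw [← hu _ ((hiff σ k).1 ⟨h4, h5⟩), inv_mul_cancel_right]

/-! ### Level sets of the tropical sign -/

theorem encard_le_of_ne_univ {d : ℕ} {K : Set (Fin (d + 1))} (hK : K ≠ Set.univ) :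
    K.encard ≤ (d : ℕ∞) := by
  have h := (Set.toFinite K).encard_lt_encard (Set.ssubset_univ_iff.2 hK)
  rw [Set.encard_univ, ENat.card_eq_coe_fintype_card, Fintype.card_fin, Nat.cast_add,
    Nat.cast_one] at h
  exact Order.le_of_lt_add_one h

theorem mainTheorem2 (d : ℕ) (hd : 2 ≤ d) :
    (∀ p : Fin d → TropProj d,
      {x : TropProj d | tropTau p x = 1} = ∅ ∨
      ∃ (a : Fin (d + 1) → ℝ) (F : Set (Set (TropProj d))),
        (∀ S ∈ F, IsOpenSector a S) ∧ F.Nonempty ∧ F.encard ≤ (d : ℕ∞) ∧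
        {x : TropProj d | tropTau p x = 1} = ⋃₀ F) ∧
    (∀ (a : Fin (d + 1) → ℝ) (F : Set (Set (TropProj d))),
      (∀ S ∈ F, IsOpenSector a S) → F.encard ≤ (d : ℕ∞) →
      ∃ u : Fin d → TropProj d,
        (∀ i, u i ∈ tropVertices (tropHypersimplex d 2)) ∧
        {x : TropProj d | tropTau (fun i => tropPoint (-a) + u i) x = 1} = ⋃₀ F) := by
  have : NeZero d := ⟨by omega⟩
  refine ⟨fun p => ?_, fun a F hF hcard => ?_⟩
  · choose w hw using fun i => tropPoint_surjective (p i)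
    obtain rfl : (fun i => tropPoint (w i)) = p := funext hw
    obtain ⟨A, hA⟩ := exists_isTropMinors w
    rw [setOf_tropTau_eq_one hA]
    rcases Set.eq_empty_or_nonempty {k | IsPositiveMinor w A k} with h | h
    · left
      rw [h, Set.image_empty, Set.sUnion_empty]
    · refine Or.inr ⟨A, _, ?_, h.image _, ?_, rfl⟩
      · rintro _ ⟨k, -, rfl⟩
        exact isOpenSector_iff.2 ⟨k, rfl⟩
      · obtain ⟨k, hk⟩ := exists_not_isPositiveMinor hA
        exact (Set.encard_image_le _ _).trans (encard_le_of_ne_univ fun h => hk (Set.eq_univ_iff_forall.1 h k))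
  · let K : Set (Fin (d + 1)) := tropSector a ⁻¹' F
    have hFK : tropSector a '' K = F :=
      Set.image_preimage_eq_of_subset fun S hS => isOpenSector_iff.1 (hF S hS)
    rcases Set.eq_empty_or_nonempty K with hK | ⟨r, hr⟩
    · have h01 : (0 : Fin (d + 1)) ≠ 1 := by simp
      refine ⟨fun _ => _, fun _ => tropPoint_mem_tropVertices_tropHypersimplex h01, ?_⟩
      obtain ⟨A, hA⟩ := exists_isTropMinors fun _ : Fin d =>
        -a + ∑ k ∈ {0, 1}, -(Pi.single k 1 : Fin (d + 1) → ℝ)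
      have hempty : {k | IsPositiveMinor (fun _ : Fin d =>
          -a + ∑ k ∈ {0, 1}, -(Pi.single k 1 : Fin (d + 1) → ℝ)) A k} = ∅ :=
        Set.eq_empty_of_forall_notMem fun k => not_isPositiveMinor_of_eq
          (i := ⟨0, by omega⟩) (j := ⟨1, by omega⟩) (by simp) rfl k
      have := setOf_tropTau_eq_one hA
      rw [hempty, Set.image_empty] at this
      rw [← hFK, hK, Set.image_empty]
      exact this
    · obtain ⟨s, hs⟩ : ∃ s, s ∉ K := by
        by_contra! h
        rw [← hFK, (tropSector_injective a).encard_image, Set.eq_univ_of_forall h, Set.encard_univ,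
          ENat.card_eq_coe_fintype_card, Fintype.card_fin, Nat.cast_le] at hcard
        omega
      obtain ⟨J, c, hJ, hA, hpos⟩ := exists_vertices_isPositiveMinor_iff hd a hr hs
      refine ⟨fun i => tropPoint (∑ m ∈ J i, -(Pi.single m 1 : Fin (d + 1) → ℝ)), fun i => ?_, ?_⟩
      · obtain ⟨v, v', hv, hi⟩ := hJ i
        simp only [hi]
        exact tropPoint_mem_tropVertices_tropHypersimplex hv
      · have := setOf_tropTau_eq_one hA
        simp only [hpos, Set.ofPred_mem_eq, tropSector_congr (a := a) fun _ => rfl, hFK] at this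
        exact this
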